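/- Let $N\ge 2$, let $\Omega\subset\mathbb{R}^N$ be a bounded domain (nonempty, open, connected), let $b\in C(\partial\Omega)$, and let $f\in C(\Omega\times\mathbb{R},\mathbb{R})$ satisfy $\sup_{\Omega\times I}|f(x,t)|<\infty$ for every compact interval $I\subset\mathbb{R}$. Put $\sigma=3^{4/3}/4$, $\ell=\inf_{\partial\Omega}b$, $L=\sup_{\partial\Omega}b$, $f^+=\max\{f,0\}$, $f^-=\min\{f,0\}$, and for $\eta\ge 0$ $$C(\eta)=\max\Big\{\Big(\sup_{\Omega\times[\ell-\eta,\,\ell]}f^+(x,t)\Big)^{1/3},\ -\Big(\inf_{\Omega\times[L,\,L+\eta]}f^-(x,t)\Big)^{1/3}\Big\},$$ where the cube root of a nonpositive number is the real one. Suppose that $$\operatorname{diam}(\Omega)<\sup_{\eta>0}\Big(\frac{\eta}{\sigma\,C(\eta)}\Big)^{3/4},$$ where the right-hand side may be $+\infty$ and is understood to be $+\infty$ if $C(\eta)=0$ for some $\eta\ge 0$. Then the Dirichlet problem $$\Delta_\infty u=f(x,u)\ \text{ in }\Omega,\qquad u=b\ \text{ on }\partial\Omega,$$ with $\Delta_\infty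 u=\langle D^2u\,Du,Du\rangle$, has a viscosity solution $u\in C(\overline\Omega)$. That is, there is $u\in C(\overline\Omega)$ with $u=b$ on $\partial\Omega$ such that, for every $\psi\in C^2(\Omega)$ and $x_0\in\Omega$: if $u-\psi$ has a local maximum at $x_0$, then $\Delta_\infty\psi(x_0)\ge f(x_0,u(x_0))$; and if $u-\psi$ has a local minimum at $x_0$, then $\Delta_\infty\psi(x_0)\le f(x_0,u(x_0))$. -/

import Mathlib

open scoped ENNReal

namespace InfDirichlet

noncomputable section

/-- The infinity Laplacian `⟨D²ψ Dψ, Dψ⟩` at `x`. -/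
def infLaplacian {N : ℕ} (ψ : EuclideanSpace ℝ (Fin N) → ℝ) (x : EuclideanSpace ℝ (Fin N)) : ℝ :=
  fderiv ℝ (fderiv ℝ ψ) x (gradient ψ x) (gradient ψ x)

/-- `u ∈ C(Ω)` is a viscosity sub-solution of `Δ_∞ u = f(x, u)` in `Ω`. -/
def IsSubsolution {N : ℕ} (Ω : Set (EuclideanSpace ℝ (Fin N)))
    (f : EuclideanSpace ℝ (Fin N) → ℝ → ℝ) (u : EuclideanSpace ℝ (Fin N) → ℝ) : Prop :=
  ContinuousOn u Ω ∧
    ∀ ψ : EuclideanSpace ℝ (Fin N) → ℝ, ContDiffOn ℝ 2 ψ Ω →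
      ∀ x₀ ∈ Ω, IsLocalMaxOn (fun x => u x - ψ x) Ω x₀ → f x₀ (u x₀) ≤ infLaplacian ψ x₀

/-- `u ∈ C(Ω)` is a viscosity super-solution of `Δ_∞ u = f(x, u)` in `Ω`. -/
def IsSupersolution {N : ℕ} (Ω : Set (EuclideanSpace ℝ (Fin N)))
    (f : EuclideanSpace ℝ (Fin N) → ℝ → ℝ) (u : EuclideanSpace ℝ (Fin N) → ℝ) : Prop :=
  ContinuousOn u Ω ∧
    ∀ ψ : EuclideanSpace ℝ (Fin N) → ℝ, ContDiffOn ℝ 2 ψ Ω →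
      ∀ x₀ ∈ Ω, IsLocalMinOn (fun x => u x - ψ x) Ω x₀ → infLaplacian ψ x₀ ≤ f x₀ (u x₀)

/-- `u ∈ C(Ω̄)` is a viscosity solution of `Δ_∞ u = f(x, u)` in `Ω`, `u = b` on `∂Ω`. -/
def IsDirichletSolution {N : ℕ} (Ω : Set (EuclideanSpace ℝ (Fin N)))
    (f : EuclideanSpace ℝ (Fin N) → ℝ → ℝ) (b u : EuclideanSpace ℝ (Fin N) → ℝ) : Prop :=
  ContinuousOn u (closure Ω) ∧ IsSubsolution Ω f u ∧ IsSupersolution Ω f u ∧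
    ∀ x ∈ frontier Ω, u x = b x

/-- `σ = 3^{4/3} / 4`. -/
def sigma : ℝ := (3 : ℝ) ^ (4 / 3 : ℝ) / 4

/-- `ℓ = inf_{∂Ω} b`. -/
def bdryInf {N : ℕ} (Ω : Set (EuclideanSpace ℝ (Fin N)))
    (b : EuclideanSpace ℝ (Fin N) → ℝ) : ℝ := sInf (b '' frontier Ω)

/-- `L = sup_{∂Ω} b`. -/
def bdrySup {N : ℕ} (Ω : Set (EuclideanSpace ℝ (Fin N)))
    (b : EuclideanSpace ℝ (Fin N) → ℝ) : ℝ := sSup (b '' frontier Ω)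

/-- `C(η)`: the larger of `(sup_{Ω × [ℓ-η, ℓ]} f⁺)^{1/3}` and `-(inf_{Ω × [L, L+η]} f⁻)^{1/3}`, with
`f⁺ = max f 0` and `f⁻ = min f 0`. The infimum is nonpositive and its cube root is the real one, so
the second number is `(-inf f⁻)^{1/3}`. The suprema are used only for `f` bounded on these sets. -/
def sizeConst {N : ℕ} (Ω : Set (EuclideanSpace ℝ (Fin N)))
    (f : EuclideanSpace ℝ (Fin N) → ℝ → ℝ) (b : EuclideanSpace ℝ (Fin N) → ℝ) (η : ℝ) : ℝ :=
  max
    (sSup ((fun p : EuclideanSpace ℝ (Fin N) × ℝ => max (f p.1 p.2) 0) ''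
      (Ω ×ˢ Set.Icc (bdryInf Ω b - η) (bdryInf Ω b))) ^ (1 / 3 : ℝ))
    ((-sInf ((fun p : EuclideanSpace ℝ (Fin N) × ℝ => min (f p.1 p.2) 0) ''
      (Ω ×ˢ Set.Icc (bdrySup Ω b) (bdrySup Ω b + η)))) ^ (1 / 3 : ℝ))

open Classical in
/-- `sup_{η > 0} (η / (σ C(η)))^{3/4}` in `[0, ∞]`, read as `∞` if `C(η) = 0` for some `η ≥ 0`. -/
def diamBound {N : ℕ} (Ω : Set (EuclideanSpace ℝ (Fin N)))
    (f : EuclideanSpace ℝ (Fin N) → ℝ → ℝ) (b : EuclideanSpace ℝ (Fin N) → ℝ) : ℝ≥0∞ :=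
  if ∃ η : ℝ, 0 ≤ η ∧ sizeConst Ω f b η = 0 then ⊤
  else ⨆ (η : ℝ) (_ : 0 < η), ENNReal.ofReal ((η / (sigma * sizeConst Ω f b η)) ^ (3 / 4 : ℝ))

end

end InfDirichlet

open Filter Topology Set Metric

namespace InfDirichlet

/-! ### Pointwise calculus of the infinity Laplacian -/

section Calculus

variable {N : ℕ}

/-! The right-hand side is truncated in `t` to `[ℓ - η, L + η]`, which makes it bounded. The
truncated problem is solved, and the solution is shown to stay in that interval, where truncation
changes nothing.

Both halves rest on the radial functions `c + a|x - z|^(2p)`. For `p = 1/4` and `a` large the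
infinity Laplacian is below any prescribed `-M` on bounded sets, away from `z`. Cones `|x -
z|^(1/2)` with vertex on the boundary are therefore barriers at every boundary point, with no
regularity of `∂Ω` (`exists_barriers`); with vertex inside they give a Hölder estimate common to all
bounded subsolutions (`exists_holder_estimate`). The supremum of the subsolutions below `b` is thus
continuous up to the boundary, and Perron's method works with continuous functions, without
semicontinuous envelopes. The only comparison used is with strict classical supersolutions
(`IsSubsolution.le_of_strict`), which is immediate from the definition.

For `p = 2/3` the infinity Laplacian is constant, and `σ` normalises it: `σ C |x - z|^(4/3)` has
infinity Laplacian `C³`. Comparison with its negative bounds the excess of `u` over `L` by `σ C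
diam^(4/3)` (`IsSubsolution.le_add_of_rhs_ge`), and the same for `-u` bounds it below `ℓ`. The
diameter hypothesis provides an `η` for which this quantity is at most `η`. -/

theorem infLaplacian_congr {ψ φ : EuclideanSpace ℝ (Fin N) → ℝ} {x : EuclideanSpace ℝ (Fin N)}
    (h : ψ =ᶠ[𝓝 x] φ) : infLaplacian ψ x = infLaplacian φ x := by
  unfold infLaplacian
  rw [h.fderiv.fderiv_eq, h.gradient_eq]

/-- The inner product, as a real bilinear map. -/
noncomputable def innerForm (N : ℕ) :
    EuclideanSpace ℝ (Fin N) →L[ℝ] EuclideanSpace ℝ (Fin N) →L[ℝ] ℝ := innerSL ℝ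

@[simp]
theorem innerForm_apply (x y : EuclideanSpace ℝ (Fin N)) : innerForm N x y = inner ℝ x y := rfl

theorem gradient_eq_of_fderiv_eq {ψ : EuclideanSpace ℝ (Fin N) → ℝ}
    {x e : EuclideanSpace ℝ (Fin N)} (h : fderiv ℝ ψ x = innerForm N e) : gradient ψ x = e := by
  refine ext_inner_right ℝ fun y => ?_
  rw [inner_gradient_left, h, innerForm_apply]

theorem contDiffAt_fderiv {ψ : EuclideanSpace ℝ (Fin N) → ℝ} {x : EuclideanSpace ℝ (Fin N)}
    (h : ContDiffAt ℝ 2 ψ x) : ContDiffAt ℝ 1 (fderiv ℝ ψ) x :=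
  h.fderiv_right (by norm_num)

theorem continuousAt_infLaplacian {ψ : EuclideanSpace ℝ (Fin N) → ℝ}
    {x : EuclideanSpace ℝ (Fin N)} (h : ContDiffAt ℝ 2 ψ x) :
    ContinuousAt (infLaplacian ψ) x := by
  have h1 := contDiffAt_fderiv h
  have h2 : ContinuousAt (fderiv ℝ (fderiv ℝ ψ)) x :=
    (h1.fderiv_right (m := 0) (by norm_num)).continuousAt
  have h3 : ContinuousAt (gradient ψ) x :=
    (InnerProductSpace.toDual ℝ _).symm.continuous.continuousAt.comp h1.continuousAt
  exact (h2.clm_apply h3).clm_apply h3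

/-- Second-order necessary condition at a local maximum. -/
theorem fderiv_fderiv_nonpos_of_isLocalMax {g : EuclideanSpace ℝ (Fin N) → ℝ}
    {x : EuclideanSpace ℝ (Fin N)} (hg : ContDiffAt ℝ 2 g x) (hmax : IsLocalMax g x)
    (e : EuclideanSpace ℝ (Fin N)) : fderiv ℝ (fderiv ℝ g) x e e ≤ 0 := by
  by_contra! hpos
  set d := fderiv ℝ (fderiv ℝ g) x e e with hd
  let γ : ℝ → EuclideanSpace ℝ (Fin N) := fun t => x + t • e
  have hγ0 : γ 0 = x := by simp [γ]
  have hγ : ∀ t, HasDerivAt γ e t := fun t => by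
    simpa [γ] using! ((hasDerivAt_id t).smul_const e).const_add x
  have hγt : Tendsto γ (𝓝 0) (𝓝 x) := by
    simpa [hγ0] using (hγ 0).continuousAt.tendsto
  have hdiff : ∀ᶠ y in 𝓝 x, DifferentiableAt ℝ g y :=
    (hg.eventually (by simp)).mono fun y hy => hy.differentiableAt (by norm_num)
  -- Subtracting only half of the quadratic term leaves `k''(0) = d/2 > 0`, so `k` has a local
  -- minimum at `0`. Hence `g (γ t) ≥ g x + (d/4) t²`, against maximality.
  let k : ℝ → ℝ := fun t => g (γ t) - d / 4 * t ^ 2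
  have hk : ∀ᶠ t in 𝓝 (0 : ℝ), HasDerivAt k (fderiv ℝ g (γ t) e - d / 2 * t) t := by
    filter_upwards [hγt.eventually hdiff] with t ht
    have h1 := ht.hasFDerivAt.comp_hasDerivAt t (hγ t)
    have h2 := ((hasDerivAt_id t).pow 2).const_mul (d / 4)
    refine (h1.sub h2).congr_deriv ?_
    simp; ring
  have hk' : deriv k =ᶠ[𝓝 0] fun t => fderiv ℝ g (γ t) e - d / 2 * t :=
    hk.mono fun t ht => ht.deriv
  have hk0 : deriv k 0 = 0 := by
    rw [hk'.eq_of_nhds, hγ0, hmax.fderiv_eq_zero]; simp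
  have hkk : deriv (deriv k) 0 = d / 2 := by
    rw [hk'.deriv_eq]
    have h1 : HasFDerivAt (fderiv ℝ g) (fderiv ℝ (fderiv ℝ g) x) (γ 0) := by
      rw [hγ0]
      exact ((contDiffAt_fderiv hg).differentiableAt (by norm_num)).hasFDerivAt
    have h2 := (h1.comp_hasDerivAt 0 (hγ 0)).clm_apply (hasDerivAt_const (0 : ℝ) e)
    have h3 := (hasDerivAt_id (0 : ℝ)).const_mul (d / 2)
    refine ((h2.sub h3).congr_deriv ?_).deriv
    simp [← hd]; ring
  have hmin : IsLocalMin k 0 := by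
    refine isLocalMin_of_deriv_deriv_pos ?_ hk0 hk.self_of_nhds.continuousAt
    rw [hkk]; linarith
  have hmax' : ∀ᶠ t in 𝓝 (0 : ℝ), g (γ t) ≤ g x := hγt.eventually hmax
  have hev : ∀ᶠ t in 𝓝[≠] (0 : ℝ), False := by
    filter_upwards [nhdsWithin_le_nhds hmax', nhdsWithin_le_nhds hmin, self_mem_nhdsWithin]
      with t h1 h2 h3
    simp only [k, hγ0] at h2
    have : 0 < t ^ 2 := by have : t ≠ 0 := h3
                           positivity
    nlinarith
  exact hev.exists.elim fun _ h => h

/-- At the maximum the gradients agree and the Hessian of the difference is nonpositive; it is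
evaluated on the common gradient. -/
theorem infLaplacian_le_of_isLocalMax_sub {ψ φ : EuclideanSpace ℝ (Fin N) → ℝ}
    {x : EuclideanSpace ℝ (Fin N)} (hψ : ContDiffAt ℝ 2 ψ x) (hφ : ContDiffAt ℝ 2 φ x)
    (hmax : IsLocalMax (fun y => ψ y - φ y) x) : infLaplacian ψ x ≤ infLaplacian φ x := by
  have d1 : ∀ {g : EuclideanSpace ℝ (Fin N) → ℝ}, ContDiffAt ℝ 2 g x →
      ∀ᶠ y in 𝓝 x, DifferentiableAt ℝ g y := fun hg =>
    (hg.eventually (by simp)).mono fun y hy => hy.differentiableAt (by norm_num)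
  have hfd : fderiv ℝ (fun y => ψ y - φ y) =ᶠ[𝓝 x] fun y => fderiv ℝ ψ y - fderiv ℝ φ y := by
    filter_upwards [d1 hψ, d1 hφ] with y h1 h2
    exact fderiv_fun_sub h1 h2
  have h0 : fderiv ℝ ψ x = fderiv ℝ φ x :=
    sub_eq_zero.1 (hfd.eq_of_nhds ▸ hmax.fderiv_eq_zero)
  have hgrad : gradient ψ x = gradient φ x := by simp [gradient, h0]
  have h2 := fderiv_fderiv_nonpos_of_isLocalMax (hψ.sub hφ) hmax (gradient φ x)
  have h3 : fderiv ℝ (fderiv ℝ (ψ - φ)) x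
      = fderiv ℝ (fderiv ℝ ψ) x - fderiv ℝ (fderiv ℝ φ) x := by
    rw [← fderiv_fun_sub ((contDiffAt_fderiv hψ).differentiableAt (by norm_num))
      ((contDiffAt_fderiv hφ).differentiableAt (by norm_num))]
    exact hfd.fderiv_eq
  rw [show (fun y => ψ y - φ y) = ψ - φ from rfl] at *
  rw [h3] at h2
  unfold infLaplacian
  rw [hgrad]
  simpa using h2

theorem infLaplacian_add_const (ψ : EuclideanSpace ℝ (Fin N) → ℝ) (c : ℝ)
    (x : EuclideanSpace ℝ (Fin N)) : infLaplacian (fun y => ψ y + c) x = infLaplacian ψ x := by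
  have h : fderiv ℝ (fun y => ψ y + c) = fderiv ℝ ψ := by ext1 y; simp
  simp [infLaplacian, gradient, h]

theorem infLaplacian_neg (ψ : EuclideanSpace ℝ (Fin N) → ℝ)
    (x : EuclideanSpace ℝ (Fin N)) : infLaplacian (fun y => -ψ y) x = -infLaplacian ψ x := by
  have h : fderiv ℝ (fun y => -ψ y) = fun y => -fderiv ℝ ψ y := by ext1 y; simp
  simp [infLaplacian, gradient, h]

theorem hasFDerivAt_norm_sub_sq (z x : EuclideanSpace ℝ (Fin N)) :
    HasFDerivAt (fun y => ‖y - z‖ ^ 2) ((2 : ℝ) • innerForm N (x - z)) x := by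
  refine ((hasFDerivAt_id x).sub_const z).norm_sq.congr_fderiv ?_
  ext y; simp

theorem hasFDerivAt_innerForm_sub (z x : EuclideanSpace ℝ (Fin N)) :
    HasFDerivAt (fun y => innerForm N (y - z)) (innerForm N) x := by
  exact (innerForm N).hasFDerivAt.comp x
    ((hasFDerivAt_id x).sub_const z)

theorem contDiff_norm_sub_sq (z : EuclideanSpace ℝ (Fin N)) :
    ContDiff ℝ 2 (fun y => ‖y - z‖ ^ 2) :=
  (contDiff_id.sub contDiff_const).norm_sq ℝ

/-- Adding a multiple of `‖x - x₀‖²` changes the infinity Laplacian at `x₀` by a multiple of the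
squared length of the gradient. -/
theorem infLaplacian_add_mul_norm_sq {φ : EuclideanSpace ℝ (Fin N) → ℝ}
    {x : EuclideanSpace ℝ (Fin N)} (hφ : ContDiffAt ℝ 2 φ x) (δ : ℝ) :
    infLaplacian (fun y => φ y + δ * ‖y - x‖ ^ 2) x
      = infLaplacian φ x + 2 * δ * ‖gradient φ x‖ ^ 2 := by
  have hev : fderiv ℝ (fun y => φ y + δ * ‖y - x‖ ^ 2)
      =ᶠ[𝓝 x] fun y => fderiv ℝ φ y + δ • (2 : ℝ) • innerForm N (y - x) := by
    filter_upwards [hφ.eventually (by simp)] with y hy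
    exact ((hy.differentiableAt (by norm_num)).hasFDerivAt.add
      ((hasFDerivAt_norm_sub_sq x y).const_mul δ)).fderiv
  have h1 : fderiv ℝ (fderiv ℝ (fun y => φ y + δ * ‖y - x‖ ^ 2)) x
      = fderiv ℝ (fderiv ℝ φ) x + δ • (2 : ℝ) • innerForm N := by
    rw [hev.fderiv_eq]
    exact (((contDiffAt_fderiv hφ).differentiableAt (by norm_num)).hasFDerivAt.add
      (((hasFDerivAt_innerForm_sub x x).const_smul (2 : ℝ)).const_smul δ)).fderiv
  have h0 : gradient (fun y => φ y + δ * ‖y - x‖ ^ 2) x = gradient φ x := by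
    unfold gradient
    rw [hev.eq_of_nhds]; simp
  unfold infLaplacian
  rw [h0, h1]
  simp
  ring

/-- The radial profile `c + a |x - z|^{2p}`. -/
noncomputable def radialPower (z : EuclideanSpace ℝ (Fin N)) (p a c : ℝ)
    (x : EuclideanSpace ℝ (Fin N)) : ℝ := c + a * (‖x - z‖ ^ 2) ^ p

theorem norm_sub_sq_ne_zero {x z : EuclideanSpace ℝ (Fin N)} (h : x ≠ z) : ‖x - z‖ ^ 2 ≠ 0 := by
  simpa [sub_eq_zero] using h

theorem contDiffAt_radialPower {x z : EuclideanSpace ℝ (Fin N)} (h : x ≠ z) (p a c : ℝ) :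
    ContDiffAt ℝ 2 (radialPower z p a c) x :=
  contDiffAt_const.add (contDiffAt_const.mul
    ((contDiff_norm_sub_sq z).contDiffAt.rpow_const_of_ne (norm_sub_sq_ne_zero h)))

theorem continuous_radialPower (z : EuclideanSpace ℝ (Fin N)) {p : ℝ} (hp : 0 ≤ p) (a c : ℝ) :
    Continuous (radialPower z p a c) := by
  unfold radialPower
  exact continuous_const.add (continuous_const.mul
    (((continuous_id.sub continuous_const).norm.pow 2).rpow_const fun _ => Or.inr hp))

theorem radialPower_self (z : EuclideanSpace ℝ (Fin N)) {p : ℝ} (hp : p ≠ 0) (a c : ℝ) :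
    radialPower z p a c z = c := by
  simp [radialPower, Real.zero_rpow hp]

/-- The two exponents that matter are `p = 1/4`, where the factor `2p - 1` is negative, and `p =
2/3`, where the power `3p - 2` vanishes and the value is constant. -/
theorem infLaplacian_radialPower {x z : EuclideanSpace ℝ (Fin N)} (h : x ≠ z) (p a c : ℝ) :
    infLaplacian (radialPower z p a c) x
      = 8 * a ^ 3 * p ^ 3 * (2 * p - 1) * (‖x - z‖ ^ 2) ^ (3 * p - 2) := by
  have hfd : ∀ y, y ≠ z → HasFDerivAt (radialPower z p a c)
      ((2 * a * p * (‖y - z‖ ^ 2) ^ (p - 1)) • innerForm N (y - z)) y := fun y hy => by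
    refine ((((hasFDerivAt_norm_sub_sq z y).rpow_const
      (Or.inl (norm_sub_sq_ne_zero hy))).const_mul a).const_add c).congr_fderiv ?_
    ext e; simp; ring
  have hev : fderiv ℝ (radialPower z p a c)
      =ᶠ[𝓝 x] fun y => (2 * a * p * (‖y - z‖ ^ 2) ^ (p - 1)) • innerForm N (y - z) := by
    filter_upwards [isOpen_ne.mem_nhds h] with y hy using (hfd y hy).fderiv
  have hgrad : gradient (radialPower z p a c) x
      = (2 * a * p * (‖x - z‖ ^ 2) ^ (p - 1)) • (x - z) := by
    apply gradient_eq_of_fderiv_eq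
    rw [(hfd x h).fderiv, map_smul]
  have h2 := ((((hasFDerivAt_norm_sub_sq z x).rpow_const (p := p - 1)
      (Or.inl (norm_sub_sq_ne_zero h))).const_mul (2 * a * p)).smul
      (hasFDerivAt_innerForm_sub z x))
  have h3 := hev.fderiv_eq.trans h2.fderiv
  unfold infLaplacian
  rw [hgrad, h3]
  have hs : 0 < ‖x - z‖ ^ 2 := lt_of_le_of_ne (by positivity) (norm_sub_sq_ne_zero h).symm
  have e1 : inner ℝ (x - z) (x - z) = ‖x - z‖ ^ 2 := real_inner_self_eq_norm_sq _
  simp only [add_apply, smul_apply,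
    ContinuousLinearMap.smulRight_apply, innerForm_apply, map_smul, e1, smul_eq_mul]
  generalize ‖x - z‖ ^ 2 = s at hs
  have r1 : s ^ (p - 1 - 1) = s ^ p / s ^ 2 := by
    rw [show p - 1 - 1 = p - (2 : ℕ) by norm_num; ring, Real.rpow_sub_natCast hs.ne']
  have r2 : s ^ (p - 1) = s ^ p / s := by rw [Real.rpow_sub_one hs.ne']
  have r3 : s ^ (3 * p - 2) = (s ^ p) ^ 3 / s ^ 2 := by
    rw [show 3 * p - 2 = p * (3 : ℕ) - (2 : ℕ) by norm_num; ring, Real.rpow_sub_natCast hs.ne',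
      Real.rpow_mul_natCast hs.le]
  rw [r1, r2, r3]
  field_simp
  ring

end Calculus

/-! ### Localisation of the test functions -/

section Localisation

variable {N : ℕ} {Ω : Set (EuclideanSpace ℝ (Fin N))}
  {f : EuclideanSpace ℝ (Fin N) → ℝ → ℝ} {u : EuclideanSpace ℝ (Fin N) → ℝ}

/-- A bump function extends a germ globally, so viscosity inequalities may be tested with functions
that are `C²` only near the contact point. -/
theorem exists_contDiff_eventuallyEq {φ : EuclideanSpace ℝ (Fin N) → ℝ}
    {x : EuclideanSpace ℝ (Fin N)} (hφ : ContDiffAt ℝ 2 φ x) :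
    ∃ ψ : EuclideanSpace ℝ (Fin N) → ℝ, ContDiff ℝ 2 ψ ∧ ψ =ᶠ[𝓝 x] φ := by
  obtain ⟨r, hr, hball⟩ := Metric.eventually_nhds_iff_ball.1 (hφ.eventually (by simp))
  let χ : ContDiffBump x := ⟨r / 4, r / 2, by positivity, by linarith⟩
  refine ⟨fun y => χ y * φ y, ?_, ?_⟩
  · rw [contDiff_iff_contDiffAt]
    intro y
    by_cases hy : y ∈ ball x r
    · exact χ.contDiffAt.mul (hball y hy)
    · have : (fun y => χ y * φ y) =ᶠ[𝓝 y] fun _ => 0 := by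
        have hy' : y ∈ (closedBall x (r / 2))ᶜ := by
          simp only [mem_ball, mem_compl_iff, mem_closedBall, not_lt, not_le] at hy ⊢
          linarith
        filter_upwards [isClosed_closedBall.isOpen_compl.mem_nhds hy'] with w hw
        rw [χ.zero_of_le_dist, zero_mul]
        simp only [mem_compl_iff, mem_closedBall, not_le] at hw
        exact hw.le
      exact contDiffAt_const.congr_of_eventuallyEq this
  · filter_upwards [χ.eventuallyEq_one] with y hy
    simp [hy]

theorem isSubsolution_iff (hΩ : IsOpen Ω) : IsSubsolution Ω f u ↔ ContinuousOn u Ω ∧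
    ∀ x₀ ∈ Ω, ∀ φ : EuclideanSpace ℝ (Fin N) → ℝ, ContDiffAt ℝ 2 φ x₀ →
      IsLocalMax (fun x => u x - φ x) x₀ → f x₀ (u x₀) ≤ infLaplacian φ x₀ := by
  refine and_congr_right fun _ => ⟨fun h x₀ hx φ hφ hmax => ?_, fun h φ hφ x₀ hx hmax => ?_⟩
  · obtain ⟨ψ, hψ, he⟩ := exists_contDiff_eventuallyEq hφ
    rw [← infLaplacian_congr he]
    refine h ψ hψ.contDiffOn x₀ hx (IsLocalMax.on ?_ _)
    exact hmax.congr (he.mono fun y hy => by simp [hy])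
  · exact h x₀ hx φ (hφ.contDiffAt (hΩ.mem_nhds hx)) (hmax.isLocalMax (hΩ.mem_nhds hx))

theorem isSupersolution_iff (hΩ : IsOpen Ω) : IsSupersolution Ω f u ↔ ContinuousOn u Ω ∧
    ∀ x₀ ∈ Ω, ∀ φ : EuclideanSpace ℝ (Fin N) → ℝ, ContDiffAt ℝ 2 φ x₀ →
      IsLocalMin (fun x => u x - φ x) x₀ → infLaplacian φ x₀ ≤ f x₀ (u x₀) := by
  refine and_congr_right fun _ => ⟨fun h x₀ hx φ hφ hmin => ?_, fun h φ hφ x₀ hx hmin => ?_⟩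
  · obtain ⟨ψ, hψ, he⟩ := exists_contDiff_eventuallyEq hφ
    rw [← infLaplacian_congr he]
    refine h ψ hψ.contDiffOn x₀ hx (IsLocalMin.on ?_ _)
    exact hmin.congr (he.mono fun y hy => by simp [hy])
  · exact h x₀ hx φ (hφ.contDiffAt (hΩ.mem_nhds hx)) (hmin.isLocalMin (hΩ.mem_nhds hx))

end Localisation

/-! ### Comparison with strict classical supersolutions -/

section Comparison

variable {N : ℕ} {Ω : Set (EuclideanSpace ℝ (Fin N))}
  {f : EuclideanSpace ℝ (Fin N) → ℝ → ℝ} {u v w : EuclideanSpace ℝ (Fin N) → ℝ}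

/-- At a positive maximum of `v - φ` the function `φ` is itself a test function, contradicting
strictness. Strictness is asked only where `φ < v`, and smoothness only on `U`, so that the vertex
of a cone can be excluded. -/
theorem IsSubsolution.le_of_strict (hΩ : IsOpen Ω) (hv : IsSubsolution Ω f v)
    {K U : Set (EuclideanSpace ℝ (Fin N))} (hK : IsCompact K) (hU : IsOpen U) (hUK : U ⊆ K)
    (hUΩ : U ⊆ Ω) (hvK : ContinuousOn v K) {φ : EuclideanSpace ℝ (Fin N) → ℝ}
    (hφK : ContinuousOn φ K) (hφ : ∀ x ∈ U, ContDiffAt ℝ 2 φ x)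
    (hstrict : ∀ x ∈ U, φ x < v x → infLaplacian φ x < f x (v x))
    (hbd : ∀ x ∈ K, x ∉ U → v x ≤ φ x) : ∀ x ∈ K, v x ≤ φ x := by
  intro x hx
  obtain ⟨y, hy, hmax⟩ := hK.exists_isMaxOn ⟨x, hx⟩ (hvK.sub hφK)
  have h1 : v x - φ x ≤ v y - φ y := hmax hx
  rcases le_or_gt (v y) (φ y) with h | h
  · linarith
  · have hyU : y ∈ U := by
      by_contra hyU
      exact absurd (hbd y hy hyU) (not_le.2 h)
    have hloc : IsLocalMax (fun x => v x - φ x) y :=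
      hmax.isLocalMax (mem_of_superset (hU.mem_nhds hyU) hUK)
    exact absurd (((isSubsolution_iff hΩ).1 hv).2 y (hUΩ hyU) φ (hφ y hyU) hloc)
      (not_le.2 (hstrict y hyU h))

theorem IsSupersolution.neg (hΩ : IsOpen Ω) (hu : IsSupersolution Ω f u) :
    IsSubsolution Ω (fun x t => -f x (-t)) (fun x => -u x) := by
  rw [isSubsolution_iff hΩ]
  rw [isSupersolution_iff hΩ] at hu
  refine ⟨hu.1.neg, fun x hx φ hφ hmax => ?_⟩
  have h := hu.2 x hx (fun y => -φ y) hφ.neg (hmax.neg.congr (.of_forall fun y => by ring))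
  rw [infLaplacian_neg] at h
  simp only [neg_neg]
  linarith

/-- If `u - φ` has a local maximum at `x` and `v ≤ u` near `x` with equality at `x`, then `v - φ`
has a local maximum at `x`. -/
theorem isLocalMax_sub_of_le {φ : EuclideanSpace ℝ (Fin N) → ℝ} {x : EuclideanSpace ℝ (Fin N)}
    (h : IsLocalMax (fun y => u y - φ y) x) (hle : ∀ᶠ y in 𝓝 x, v y ≤ u y) (heq : v x = u x) :
    IsLocalMax (fun y => v y - φ y) x := by
  filter_upwards [h, hle] with y h1 h2
  rw [heq]
  linarith

theorem IsSubsolution.max (hΩ : IsOpen Ω) (hv : IsSubsolution Ω f v) (hw : IsSubsolution Ω f w) :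
    IsSubsolution Ω f (fun x => max (v x) (w x)) := by
  rw [isSubsolution_iff hΩ] at *
  refine ⟨hv.1.sup hw.1, fun x hx φ hφ hmax => ?_⟩
  rcases le_total (v x) (w x) with h | h
  · rw [max_eq_right h]
    exact hw.2 x hx φ hφ (isLocalMax_sub_of_le hmax (.of_forall fun y => le_max_right _ _)
      (max_eq_right h).symm)
  · rw [max_eq_left h]
    exact hv.2 x hx φ hφ (isLocalMax_sub_of_le hmax (.of_forall fun y => le_max_left _ _)
      (max_eq_left h).symm)

theorem isSubsolution_of_classical (hΩ : IsOpen Ω) (hv : ∀ x ∈ Ω, ContDiffAt ℝ 2 v x)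
    (h : ∀ x ∈ Ω, f x (v x) ≤ infLaplacian v x) : IsSubsolution Ω f v := by
  rw [isSubsolution_iff hΩ]
  exact ⟨fun x hx => (hv x hx).continuousAt.continuousWithinAt, fun x hx φ hφ hmax =>
    (h x hx).trans (infLaplacian_le_of_isLocalMax_sub (hv x hx) hφ hmax)⟩

end Comparison

/-! ### Barriers -/

section Barriers

variable {N : ℕ} {Ω : Set (EuclideanSpace ℝ (Fin N))}
  {f : EuclideanSpace ℝ (Fin N) → ℝ → ℝ} {b u v : EuclideanSpace ℝ (Fin N) → ℝ}

/-- Steep square-root cones have very negative infinity Laplacian. -/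
theorem exists_infLaplacian_radialPower_lt (M : ℝ) {D : ℝ} (hD : 0 < D) :
    ∃ A : ℝ, 0 < A ∧ ∀ a, A ≤ a → ∀ (c : ℝ) (x z : EuclideanSpace ℝ (Fin N)), x ≠ z →
      ‖x - z‖ ≤ D → infLaplacian (radialPower z (1 / 4) a c) x < -M := by
  -- The value is `-(a³/16) |x - z|^(-5/2)`; the exponent is negative, so its size is smallest at
  -- distance `D`.
  set κ : ℝ := (D ^ 2) ^ (3 * (1 / 4) - 2 : ℝ) with hκ
  have hκ0 : 0 < κ := by positivity
  refine ⟨max 1 (16 * (|M| + 1) / κ), by positivity, fun a ha c x z hxz hx => ?_⟩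
  have ha1 : 1 ≤ a := (le_max_left _ _).trans ha
  have ha2 : 16 * (|M| + 1) / κ ≤ a := (le_max_right _ _).trans ha
  rw [infLaplacian_radialPower hxz]
  have hs : 0 < ‖x - z‖ ^ 2 := lt_of_le_of_ne (by positivity) (norm_sub_sq_ne_zero hxz).symm
  have hpow : κ ≤ (‖x - z‖ ^ 2) ^ (3 * (1 / 4) - 2 : ℝ) :=
    Real.rpow_le_rpow_of_nonpos hs (by gcongr) (by norm_num)
  rw [div_le_iff₀ hκ0] at ha2
  have ha3 : a ≤ a ^ 3 := le_self_pow₀ ha1 (by norm_num)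
  have h1 : a * κ ≤ a ^ 3 * (‖x - z‖ ^ 2) ^ (3 * (1 / 4) - 2 : ℝ) := by gcongr
  have := le_abs_self M
  nlinarith

theorem exists_modulus_at {F : Set (EuclideanSpace ℝ (Fin N))} (hF : IsCompact F)
    (hb : ContinuousOn b F) {z : EuclideanSpace ℝ (Fin N)} (hz : z ∈ F) {ε : ℝ} (hε : 0 < ε) :
    ∃ A : ℝ, ∀ a, A ≤ a → ∀ x ∈ F, |b x - b z| ≤ ε + a * (‖x - z‖ ^ 2) ^ (1 / 4 : ℝ) := by
  obtain ⟨B, hB⟩ := hF.exists_bound_of_continuousOn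
    (f := fun x => b x - b z) (hb.sub continuousOn_const)
  obtain ⟨δ, hδ, hball⟩ := Metric.continuousWithinAt_iff.1 (hb z hz) ε hε
  refine ⟨|B| / (δ ^ 2) ^ (1 / 4 : ℝ), fun a ha x hx => ?_⟩
  have hδ' : 0 < (δ ^ 2) ^ (1 / 4 : ℝ) := by positivity
  have ha0 : 0 ≤ a := le_trans (by positivity) ha
  rcases lt_or_ge (dist x z) δ with h | h
  · have h1 := hball hx h
    rw [Real.dist_eq] at h1
    have : 0 ≤ a * (‖x - z‖ ^ 2) ^ (1 / 4 : ℝ) := by positivity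
    linarith
  · rw [dist_eq_norm] at h
    have h1 : |b x - b z| ≤ B := hB x hx
    rw [div_le_iff₀ hδ'] at ha
    have h2 : a * (δ ^ 2) ^ (1 / 4 : ℝ) ≤ a * (‖x - z‖ ^ 2) ^ (1 / 4 : ℝ) := by gcongr
    have := le_abs_self B
    linarith

/-- Continuous functions on `Ω̄` which are subsolutions in `Ω` and lie below `b` on `∂Ω`. -/
def IsAdmissible (Ω : Set (EuclideanSpace ℝ (Fin N)))
    (f : EuclideanSpace ℝ (Fin N) → ℝ → ℝ) (b v : EuclideanSpace ℝ (Fin N) → ℝ) : Prop :=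
  ContinuousOn v (closure Ω) ∧ IsSubsolution Ω f v ∧ ∀ x ∈ frontier Ω, v x ≤ b x

/-- The vertex `z` is outside the open set `Ω`, so the cones are smooth there. A steep one is a
strict supersolution dominating `b`, hence every admissible function; the inverted one is itself
admissible. -/
theorem exists_barriers (hΩ : IsOpen Ω) (hbdd : Bornology.IsBounded Ω)
    (hb : ContinuousOn b (frontier Ω)) {M : ℝ} (hM : ∀ x ∈ Ω, ∀ t, |f x t| ≤ M)
    {z : EuclideanSpace ℝ (Fin N)} (hz : z ∈ frontier Ω) {ε : ℝ} (hε : 0 < ε) :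
    ∃ a : ℝ, (∀ v, IsAdmissible Ω f b v → ∀ x ∈ closure Ω,
        v x ≤ radialPower z (1 / 4) a (b z + ε) x) ∧
      IsAdmissible Ω f b (fun x => -radialPower z (1 / 4) a (ε - b z) x) := by
  have hcpt : IsCompact (closure Ω) := hbdd.isCompact_closure
  have hzΩ : ∀ x ∈ Ω, x ≠ z := fun x hx h => by
    subst h
    exact (hΩ.frontier_eq ▸ hz : x ∈ closure Ω \ Ω).2 hx
  obtain ⟨D, hD, hDz⟩ : ∃ D : ℝ, 0 < D ∧ ∀ x ∈ Ω, ‖x - z‖ ≤ D := by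
    obtain ⟨D, hD⟩ := hbdd.subset_closedBall z
    exact ⟨max D 1, by positivity, fun x hx => by
      have := hD hx
      rw [mem_closedBall, dist_eq_norm] at this
      exact this.trans (le_max_left _ _)⟩
  obtain ⟨A₁, hA₁, h₁⟩ := exists_infLaplacian_radialPower_lt (N := N) M hD
  obtain ⟨A₂, h₂⟩ := exists_modulus_at
    (hcpt.of_isClosed_subset isClosed_frontier frontier_subset_closure) hb hz hε
  refine ⟨max A₁ A₂, fun v hv => ?_, ?_, ?_, ?_⟩
  · refine hv.2.1.le_of_strict hΩ hcpt hΩ subset_closure subset_rfl hv.1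
      (continuous_radialPower z (by norm_num) _ _).continuousOn
      (fun x hx => contDiffAt_radialPower (hzΩ x hx) _ _ _) (fun x hx _ => ?_) fun x hx hxΩ => ?_
    · have h3 := h₁ _ (le_max_left A₁ A₂) (b z + ε) x z (hzΩ x hx) (hDz x hx)
      have h4 := neg_le_of_abs_le (hM x hx (v x))
      linarith
    · have hxf : x ∈ frontier Ω := hΩ.frontier_eq ▸ ⟨hx, hxΩ⟩
      have h3 := le_of_abs_le (h₂ _ (le_max_right A₁ A₂) x hxf)
      have h4 := hv.2.2 x hxf
      unfold radialPower
      linarith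
  · exact (continuous_radialPower z (by norm_num) _ _).neg.continuousOn
  · refine isSubsolution_of_classical hΩ
      (fun x hx => (contDiffAt_radialPower (hzΩ x hx) _ _ _).neg) fun x hx => ?_
    rw [infLaplacian_neg]
    have h3 := h₁ _ (le_max_left A₁ A₂) (ε - b z) x z (hzΩ x hx) (hDz x hx)
    exact (le_of_abs_le (hM x hx _)).trans (by linarith)
  · intro x hx
    have h3 := neg_le_of_abs_le (h₂ _ (le_max_right A₁ A₂) x hx)
    simp only [radialPower]
    linarith

/-- Interior Hölder estimate for bounded subsolutions. -/
theorem exists_holder_estimate (hΩ : IsOpen Ω) {M : ℝ} (hM : ∀ x ∈ Ω, ∀ t, |f x t| ≤ M)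
    (K : ℝ) {r : ℝ} (hr : 0 < r) :
    ∃ a : ℝ, ∀ v, IsSubsolution Ω f v → ∀ y, closedBall y r ⊆ Ω →
      (∀ x ∈ closedBall y r, |v x| ≤ K) → ∀ x ∈ closedBall y r,
        v x ≤ v y + a * (‖x - y‖ ^ 2) ^ (1 / 4 : ℝ) := by
  obtain ⟨A, hA, h₁⟩ := exists_infLaplacian_radialPower_lt (N := N) M hr
  have hr' : 0 < (r ^ 2) ^ (1 / 4 : ℝ) := by positivity
  refine ⟨max A (2 * K / (r ^ 2) ^ (1 / 4 : ℝ)), fun v hv y hy hK => ?_⟩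
  -- The second term makes the cone rise by at least `2K` on the bounding sphere, which covers the
  -- oscillation of `v`.
  set a := max A (2 * K / (r ^ 2) ^ (1 / 4 : ℝ))
  have hUb : ball y r \ {y} ⊆ closedBall y r := sdiff_subset.trans ball_subset_closedBall
  refine hv.le_of_strict (φ := radialPower y (1 / 4) a (v y)) hΩ (isCompact_closedBall y r)
    (isOpen_ball.sdiff isClosed_singleton) hUb (hUb.trans hy) (hv.1.mono hy)
    (continuous_radialPower y (by norm_num) _ _).continuousOn
    (fun x hx => contDiffAt_radialPower hx.2 _ _ _) (fun x hx _ => ?_) fun x hx hxU => ?_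
  · have h3 := h₁ a (le_max_left _ _) (v y) x y hx.2
      (by simpa [dist_eq_norm] using hUb hx)
    have h4 := neg_le_of_abs_le (hM x (hy (hUb hx)) (v x))
    linarith
  · by_cases hxy : x = y
    · rw [hxy, radialPower_self _ (by norm_num)]
    · have hxr : ‖x - y‖ = r := by
        refine le_antisymm (by simpa [dist_eq_norm] using hx) ?_
        by_contra! hlt
        exact hxU ⟨by simpa [dist_eq_norm] using hlt, hxy⟩
      have ha : 2 * K / (r ^ 2) ^ (1 / 4 : ℝ) ≤ a := le_max_right _ _
      rw [div_le_iff₀ hr'] at ha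
      have h5 := le_of_abs_le (hK x hx)
      have h6 := neg_le_of_abs_le (hK y (mem_closedBall_self hr.le))
      unfold radialPower
      rw [hxr]
      linarith

end Barriers

/-! ### Perron's method -/

section Perron

variable {N : ℕ} {Ω : Set (EuclideanSpace ℝ (Fin N))}
  {f : EuclideanSpace ℝ (Fin N) → ℝ → ℝ} {b u v w : EuclideanSpace ℝ (Fin N) → ℝ}

theorem IsAdmissible.max (hΩ : IsOpen Ω) (hv : IsAdmissible Ω f b v) (hw : IsAdmissible Ω f b w) :
    IsAdmissible Ω f b (fun x => max (v x) (w x)) :=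
  ⟨hv.1.sup hw.1, hv.2.1.max hΩ hw.2.1, fun x hx => max_le (hv.2.2 x hx) (hw.2.2 x hx)⟩

/-- `u` is the pointwise supremum over `Ω̄` of the admissible functions. -/
def IsPerron (Ω : Set (EuclideanSpace ℝ (Fin N)))
    (f : EuclideanSpace ℝ (Fin N) → ℝ → ℝ) (b u : EuclideanSpace ℝ (Fin N) → ℝ) : Prop :=
  ∀ x ∈ closure Ω, IsLUB {t | ∃ v, IsAdmissible Ω f b v ∧ v x = t} (u x)

theorem IsPerron.le (hu : IsPerron Ω f b u) (hv : IsAdmissible Ω f b v)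
    {x : EuclideanSpace ℝ (Fin N)} (hx : x ∈ closure Ω) : v x ≤ u x :=
  (hu x hx).1 ⟨v, hv, rfl⟩

theorem IsPerron.le_of_forall (hu : IsPerron Ω f b u) {x : EuclideanSpace ℝ (Fin N)}
    (hx : x ∈ closure Ω) {t : ℝ} (h : ∀ v, IsAdmissible Ω f b v → v x ≤ t) : u x ≤ t :=
  (hu x hx).2 (by rintro _ ⟨v, hv, rfl⟩; exact h v hv)

theorem IsPerron.exists_lt (hu : IsPerron Ω f b u) {x : EuclideanSpace ℝ (Fin N)}
    (hx : x ∈ closure Ω) {t : ℝ} (h : t < u x) : ∃ v, IsAdmissible Ω f b v ∧ t < v x := by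
  by_contra! hc
  exact absurd (hu.le_of_forall hx hc) (not_le.2 h)

theorem exists_isPerron (hΩ : IsOpen Ω) (hbdd : Bornology.IsBounded Ω)
    (hne : (frontier Ω).Nonempty) (hb : ContinuousOn b (frontier Ω)) {M : ℝ}
    (hM : ∀ x ∈ Ω, ∀ t, |f x t| ≤ M) : ∃ u, IsPerron Ω f b u := by
  obtain ⟨z, hz⟩ := hne
  obtain ⟨a, ha, hv⟩ := exists_barriers hΩ hbdd hb hM hz one_pos
  refine ⟨fun x => sSup {t | ∃ v, IsAdmissible Ω f b v ∧ v x = t}, fun x hx => isLUB_csSup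
    ⟨_, _, hv, rfl⟩ ⟨radialPower z (1 / 4) a (b z + 1) x, ?_⟩⟩
  rintro _ ⟨v, hv, rfl⟩
  exact ha v hv x hx

theorem IsPerron.eq_on_frontier (hΩ : IsOpen Ω) (hbdd : Bornology.IsBounded Ω)
    (hb : ContinuousOn b (frontier Ω)) {M : ℝ} (hM : ∀ x ∈ Ω, ∀ t, |f x t| ≤ M)
    (hu : IsPerron Ω f b u) {z : EuclideanSpace ℝ (Fin N)} (hz : z ∈ frontier Ω) :
    u z = b z := by
  have hz' := frontier_subset_closure hz
  refine le_antisymm (hu.le_of_forall hz' fun v hv => hv.2.2 z hz)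
    (le_of_forall_pos_le_add fun ε hε => ?_)
  obtain ⟨a, -, hv⟩ := exists_barriers hΩ hbdd hb hM hz hε
  have h := hu.le hv hz'
  rw [radialPower_self _ (by norm_num)] at h
  linarith

theorem IsPerron.continuousWithinAt_frontier (hΩ : IsOpen Ω) (hbdd : Bornology.IsBounded Ω)
    (hb : ContinuousOn b (frontier Ω)) {M : ℝ} (hM : ∀ x ∈ Ω, ∀ t, |f x t| ≤ M)
    (hu : IsPerron Ω f b u) {z : EuclideanSpace ℝ (Fin N)} (hz : z ∈ frontier Ω) :
    ContinuousWithinAt u (closure Ω) z := by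
  have huz := hu.eq_on_frontier hΩ hbdd hb hM hz
  have hrad : ∀ a c, Tendsto (radialPower z (1 / 4) a c) (𝓝[closure Ω] z) (𝓝 c) := fun a c => by
    have h := (continuous_radialPower z (p := 1 / 4) (by norm_num) a c).tendsto z
    rw [radialPower_self _ (by norm_num)] at h
    exact h.mono_left nhdsWithin_le_nhds
  refine tendsto_order.2 ⟨fun t ht => ?_, fun t ht => ?_⟩
  · rw [huz] at ht
    obtain ⟨a, -, hv⟩ := exists_barriers hΩ hbdd hb hM hz (half_pos (sub_pos.2 ht))
    filter_upwards [(tendsto_order.1 (hrad a ((b z - t) / 2 - b z))).2 (-t) (by linarith),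
      self_mem_nhdsWithin] with x hx hxΩ
    have := hu.le hv hxΩ
    linarith
  · rw [huz] at ht
    obtain ⟨a, ha, -⟩ := exists_barriers hΩ hbdd hb hM hz (half_pos (sub_pos.2 ht))
    filter_upwards [(tendsto_order.1 (hrad a (b z + (t - b z) / 2))).2 t (by linarith),
      self_mem_nhdsWithin] with x hx hxΩ
    exact (hu.le_of_forall hxΩ fun v hv => ha v hv x hxΩ).trans_lt hx

/-- A supremum of functions with a common Hölder modulus inherits that modulus. -/
theorem IsPerron.continuousAt (hΩ : IsOpen Ω) (hbdd : Bornology.IsBounded Ω)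
    (hne : (frontier Ω).Nonempty)
    (hb : ContinuousOn b (frontier Ω)) {M : ℝ} (hM : ∀ x ∈ Ω, ∀ t, |f x t| ≤ M)
    (hu : IsPerron Ω f b u) {x₀ : EuclideanSpace ℝ (Fin N)} (hx₀ : x₀ ∈ Ω) :
    ContinuousAt u x₀ := by
  obtain ⟨z, hz⟩ := hne
  have hcpt : IsCompact (closure Ω) := hbdd.isCompact_closure
  obtain ⟨a₀, hup, hv₀⟩ := exists_barriers hΩ hbdd hb hM hz one_pos
  set v₀ := fun x => -radialPower z (1 / 4) a₀ (1 - b z) x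
  obtain ⟨K₁, hK₁⟩ := hcpt.exists_bound_of_continuousOn hv₀.1
  obtain ⟨K₂, hK₂⟩ := hcpt.exists_bound_of_continuousOn
    (continuous_radialPower z (p := 1 / 4) (by norm_num) a₀ (b z + 1)).continuousOn
  obtain ⟨r, hr, hball⟩ := Metric.nhds_basis_closedBall.mem_iff.1 (hΩ.mem_nhds hx₀)
  obtain ⟨a, ha⟩ := exists_holder_estimate hΩ hM (max K₁ K₂) (half_pos hr)
  have key : ∀ x y, closedBall y (r / 2) ⊆ Ω → x ∈ closedBall y (r / 2) →
      u x ≤ u y + a * (‖x - y‖ ^ 2) ^ (1 / 4 : ℝ) := by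
    intro x y hy hx
    refine hu.le_of_forall (subset_closure (hy hx)) fun v hv => ?_
    -- Admissible functions have no common lower bound; replacing `v` by its maximum with the fixed
    -- `v₀` supplies one.
    have hw := hv.max hΩ hv₀
    have h1 := ha _ hw.2.1 y hy (fun p hp => ?_) x hx
    · have h2 := hu.le hw (subset_closure (hy (mem_closedBall_self (half_pos hr).le)))
      have h3 := le_max_left (v x) (v₀ x)
      linarith
    · have hpΩ := subset_closure (hy hp)
      rw [abs_le]
      constructor
      · have h2 := neg_le_of_abs_le (hK₁ p hpΩ)
        have h3 := le_max_right (v p) (v₀ p)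
        have h4 := le_max_left K₁ K₂
        linarith
      · have h2 := le_of_abs_le (hK₂ p hpΩ)
        have h3 := hup _ hw p hpΩ
        have h4 := le_max_right K₁ K₂
        linarith
  have hlim : Tendsto (radialPower x₀ (1 / 4) a 0) (𝓝 x₀) (𝓝 0) := by
    have h := (continuous_radialPower x₀ (p := 1 / 4) (by norm_num) a 0).tendsto x₀
    rwa [radialPower_self _ (by norm_num)] at h
  refine tendsto_iff_dist_tendsto_zero.2 (squeeze_zero' (.of_forall fun _ => dist_nonneg) ?_ hlim)
  filter_upwards [closedBall_mem_nhds x₀ (half_pos hr)] with y hy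
  have h1 := key y x₀ ((closedBall_subset_closedBall (by linarith)).trans hball) hy
  have h2 := key x₀ y (fun p hp => hball ?_) (mem_closedBall_comm.1 hy)
  · rw [norm_sub_rev] at h2
    rw [Real.dist_eq, abs_le]
    unfold radialPower
    constructor <;> linarith
  · rw [mem_closedBall] at *
    linarith [dist_triangle p y x₀]

theorem continuousAt_infLaplacian_sub (hΩ : IsOpen Ω)
    (hf : ContinuousOn (fun p : EuclideanSpace ℝ (Fin N) × ℝ => f p.1 p.2) (Ω ×ˢ Set.univ))
    {x₀ : EuclideanSpace ℝ (Fin N)} (hx₀ : x₀ ∈ Ω) {ψ : EuclideanSpace ℝ (Fin N) → ℝ}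
    (hψ : ContDiffAt ℝ 2 ψ x₀) (t₀ : ℝ) :
    ContinuousAt (fun p : EuclideanSpace ℝ (Fin N) × ℝ => infLaplacian ψ p.1 - f p.1 p.2)
      (x₀, t₀) :=
  (ContinuousAt.comp (f := Prod.fst) (x := (x₀, t₀)) (continuousAt_infLaplacian hψ)
    continuousAt_fst).sub (hf.continuousAt ((hΩ.prod isOpen_univ).mem_nhds ⟨hx₀, trivial⟩))

theorem exists_pos_add_mul_lt {A B : ℝ} (h : A < B) {G : ℝ} (hG : 0 ≤ G) :
    ∃ δ : ℝ, 0 < δ ∧ A + 2 * δ * G < B := by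
  refine ⟨(B - A) / (4 * (G + 1)), div_pos (by linarith) (by positivity), ?_⟩
  have : 2 * ((B - A) / (4 * (G + 1))) * G = (B - A) * (G / (2 * (G + 1))) := by
    field_simp; ring
  rw [this]
  have h1 : G / (2 * (G + 1)) < 1 := by rw [div_lt_one (by positivity)]; linarith
  nlinarith

theorem IsPerron.isSubsolution (hΩ : IsOpen Ω)
    (hf : ContinuousOn (fun p : EuclideanSpace ℝ (Fin N) × ℝ => f p.1 p.2) (Ω ×ˢ Set.univ))
    (hu : IsPerron Ω f b u) (huc : ∀ x ∈ Ω, ContinuousAt u x) : IsSubsolution Ω f u := by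
  rw [isSubsolution_iff hΩ]
  refine ⟨fun x hx => (huc x hx).continuousWithinAt, fun x₀ hx₀ φ hφ hmax => ?_⟩
  by_contra! hlt
  obtain ⟨δ, hδ, hδ'⟩ := exists_pos_add_mul_lt hlt (sq_nonneg ‖gradient φ x₀‖)
  rw [← infLaplacian_add_mul_norm_sq hφ] at hδ'
  -- The quadratic term makes the maximum strict, while `δ` is small enough to keep the reversed
  -- inequality.
  set ψ := fun y => φ y + δ * ‖y - x₀‖ ^ 2
  have hψ : ContDiffAt ℝ 2 ψ x₀ :=
    hφ.add (contDiffAt_const.mul (contDiff_norm_sub_sq x₀).contDiffAt)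
  have hψ0 : ψ x₀ = φ x₀ := by simp [ψ]
  have hev := (continuousAt_infLaplacian_sub hΩ hf hx₀ hψ (u x₀)).eventually_lt
    (continuousAt_const (y := (0 : ℝ))) (by simpa using hδ')
  obtain ⟨τ, hτ, hτ'⟩ := Metric.eventually_nhds_iff_ball.1 hev
  have hnear : ∀ᶠ x in 𝓝 x₀, x ∈ Ω ∧ dist x x₀ < τ ∧ ContDiffAt ℝ 2 ψ x ∧
      u x - φ x ≤ u x₀ - φ x₀ ∧ dist (u x) (u x₀) < τ ∧ dist (ψ x) (ψ x₀) < τ / 2 := by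
    filter_upwards [hΩ.mem_nhds hx₀, ball_mem_nhds x₀ hτ, hψ.eventually (by simp), hmax,
      (huc x₀ hx₀) (ball_mem_nhds _ hτ), hψ.continuousAt (ball_mem_nhds _ (half_pos hτ))]
      with x h1 h2 h3 h4 h5 h6 using ⟨h1, h2, h3, h4, h5, h6⟩
  obtain ⟨ρ, hρ, hρ'⟩ := Metric.nhds_basis_closedBall.eventually_iff.1 hnear
  have hx₀ρ : x₀ ∈ closedBall x₀ ρ := mem_closedBall_self hρ.le
  -- The first bound keeps the maximum of `v - ψ` off the sphere; the second keeps `v y` within `τ`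
  -- of `u x₀`.
  have hε : 0 < min (δ * ρ ^ 2) (τ / 2) := lt_min (by positivity) (half_pos hτ)
  obtain ⟨v, hv, hvx⟩ := hu.exists_lt (subset_closure hx₀) (sub_lt_self (u x₀) hε)
  have hε1 := min_le_left (δ * ρ ^ 2) (τ / 2)
  have hε2 := min_le_right (δ * ρ ^ 2) (τ / 2)
  obtain ⟨y, hy, hymax⟩ := (isCompact_closedBall x₀ ρ).exists_isMaxOn ⟨x₀, hx₀ρ⟩
    (f := fun x => v x - ψ x) (ContinuousOn.sub
      (hv.1.mono fun x hx => subset_closure (hρ' hx).1)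
      fun x hx => (hρ' hx).2.2.1.continuousAt.continuousWithinAt)
  obtain ⟨hyΩ, hyτ, hyψ, hyu, hyu', hyψ'⟩ := hρ' hy
  have h1 : v x₀ - ψ x₀ ≤ v y - ψ y := hymax hx₀ρ
  have hvu : v y ≤ u y := hu.le hv (subset_closure hyΩ)
  have hyball : y ∈ ball x₀ ρ := by
    by_contra hyb
    have hnorm : ρ ≤ ‖y - x₀‖ := by simpa [dist_eq_norm] using hyb
    have h2 : δ * ρ ^ 2 ≤ δ * ‖y - x₀‖ ^ 2 := by gcongr
    have h3 : ψ y = φ y + δ * ‖y - x₀‖ ^ 2 := rfl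
    linarith
  have hloc : IsLocalMax (fun x => v x - ψ x) y :=
    hymax.isLocalMax (mem_of_superset (isOpen_ball.mem_nhds hyball) ball_subset_closedBall)
  have h4 := ((isSubsolution_iff hΩ).1 hv.2.1).2 y hyΩ ψ hyψ hloc
  have h5 : dist (v y) (u x₀) < τ := by
    rw [Real.dist_eq, abs_lt] at *
    constructor <;> linarith
  have h6 := hτ' (y, v y) (by simp [Prod.dist_eq, hyτ, h5])
  simp only at h6
  linarith

/-- If the inequality failed at `x₀`, a strict classical subsolution touching `u` from below could
be raised slightly and glued to `u`, giving an admissible function larger than `u` at `x₀`. -/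
theorem IsPerron.isSupersolution (hΩ : IsOpen Ω)
    (hf : ContinuousOn (fun p : EuclideanSpace ℝ (Fin N) × ℝ => f p.1 p.2) (Ω ×ˢ Set.univ))
    (hu : IsPerron Ω f b u) (huadm : IsAdmissible Ω f b u) : IsSupersolution Ω f u := by
  have huc : ∀ x ∈ Ω, ContinuousAt u x := fun x hx => huadm.2.1.1.continuousAt (hΩ.mem_nhds hx)
  rw [isSupersolution_iff hΩ]
  refine ⟨huadm.2.1.1, fun x₀ hx₀ φ hφ hmin => ?_⟩
  by_contra! hlt
  obtain ⟨δ, hδ, hδ'⟩ := exists_pos_add_mul_lt hlt (sq_nonneg ‖gradient φ x₀‖)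
  set ψ := fun y => φ y + (-δ) * ‖y - x₀‖ ^ 2 + (u x₀ - φ x₀) with hψdef
  have hL : infLaplacian ψ x₀ = infLaplacian φ x₀ + 2 * (-δ) * ‖gradient φ x₀‖ ^ 2 := by
    rw [hψdef, infLaplacian_add_const, infLaplacian_add_mul_norm_sq hφ]
  have hψ : ContDiffAt ℝ 2 ψ x₀ :=
    (hφ.add (contDiffAt_const.mul (contDiff_norm_sub_sq x₀).contDiffAt)).add contDiffAt_const
  have hψ0 : ψ x₀ = u x₀ := by simp [ψ]
  have hev := (continuousAt_const (y := (0 : ℝ))).eventually_lt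
    (continuousAt_infLaplacian_sub hΩ hf hx₀ hψ (u x₀)) (by simp only; linarith)
  obtain ⟨τ, hτ, hτ'⟩ := Metric.eventually_nhds_iff_ball.1 hev
  have hnear : ∀ᶠ x in 𝓝 x₀, x ∈ Ω ∧ dist x x₀ < τ ∧ ContDiffAt ℝ 2 ψ x ∧
      u x₀ - φ x₀ ≤ u x - φ x ∧ dist (ψ x) (ψ x₀) < τ / 2 := by
    filter_upwards [hΩ.mem_nhds hx₀, ball_mem_nhds x₀ hτ, hψ.eventually (by simp), hmin,
      hψ.continuousAt (ball_mem_nhds _ (half_pos hτ))]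
      with x h1 h2 h3 h4 h5 using ⟨h1, h2, h3, h4, h5⟩
  obtain ⟨ρ, hρ, hρ'⟩ := Metric.nhds_basis_closedBall.eventually_iff.1 hnear
  obtain ⟨ε, hε, hε1, hε2⟩ : ∃ ε : ℝ, 0 < ε ∧ ε ≤ δ * (ρ / 2) ^ 2 ∧ ε ≤ τ / 2 :=
    ⟨min (δ * (ρ / 2) ^ 2) (τ / 2), lt_min (by positivity) (half_pos hτ), min_le_left _ _,
      min_le_right _ _⟩
  classical
  set w : EuclideanSpace ℝ (Fin N) → ℝ :=
    fun x => if dist x x₀ < ρ then max (u x) (ψ x + ε) else u x with hw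
  have hwin : ∀ x ∈ ball x₀ ρ, w x = max (u x) (ψ x + ε) := fun x hx => if_pos hx
  have hwin' : ∀ x ∈ ball x₀ ρ, w =ᶠ[𝓝 x] fun x => max (u x) (ψ x + ε) := fun x hx =>
    mem_of_superset (isOpen_ball.mem_nhds hx) hwin
  have huw : ∀ x, u x ≤ w x := fun x => by
    simp only [hw]; split_ifs
    · exact le_max_left _ _
    · exact le_rfl
  have hwout : ∀ x ∉ closedBall x₀ (ρ / 2), w x = u x := fun x hx => by
    simp only [hw]
    split_ifs with h
    · refine max_eq_left ?_
      have h1 := (hρ' (ball_subset_closedBall h)).2.2.2.1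
      have h2 : ρ / 2 ≤ ‖x - x₀‖ := by
        rw [mem_closedBall, dist_eq_norm, not_le] at hx; exact hx.le
      have h3 : δ * (ρ / 2) ^ 2 ≤ δ * ‖x - x₀‖ ^ 2 := by gcongr
      simp only [ψ]
      linarith
    · rfl
  have hwout' : ∀ x ∉ ball x₀ ρ, w =ᶠ[𝓝 x] u := fun x hx => by
    refine mem_of_superset (isClosed_closedBall.isOpen_compl.mem_nhds ?_) hwout
    simp only [mem_ball, not_lt, mem_compl_iff, mem_closedBall, not_le] at hx ⊢
    linarith
  have hwcont : ContinuousOn w (closure Ω) := fun x hx => by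
    by_cases hxb : x ∈ ball x₀ ρ
    · have h1 := hρ' (ball_subset_closedBall hxb)
      have h2 : ContinuousAt (fun x => max (u x) (ψ x + ε)) x :=
        (huc x h1.1).max (h1.2.2.1.continuousAt.add continuousAt_const)
      exact (h2.congr_of_eventuallyEq (hwin' x hxb)).continuousWithinAt
    · exact (huadm.1 x hx).congr_of_eventuallyEq (nhdsWithin_le_nhds (hwout' x hxb))
        (hwout' x hxb).eq_of_nhds
  have hwadm : IsAdmissible Ω f b w := by
    refine ⟨hwcont, ?_, fun x hx => ?_⟩
    · rw [isSubsolution_iff hΩ]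
      refine ⟨hwcont.mono subset_closure, fun x hx φ' hφ' hmax => ?_⟩
      -- Where `w = u`, a test function for `w` also tests `u`; elsewhere `w` equals the smooth
      -- function `ψ + ε`.
      by_cases hxw : u x = w x
      · rw [← hxw]
        exact ((isSubsolution_iff hΩ).1 huadm.2.1).2 x hx φ' hφ'
          (isLocalMax_sub_of_le hmax (.of_forall huw) hxw)
      · have hxb : x ∈ ball x₀ ρ := by
          by_contra h
          exact hxw (hwout' x h).eq_of_nhds.symm
        have hwx : ψ x + ε = w x := by
          rcases max_choice (u x) (ψ x + ε) with h | h
          · exact absurd ((hwin x hxb).trans h).symm hxw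
          · exact ((hwin x hxb).trans h).symm
        have h1 := hρ' (ball_subset_closedBall hxb)
        have hloc : IsLocalMax (fun y => (ψ y + ε) - φ' y) x :=
          isLocalMax_sub_of_le (v := fun y => ψ y + ε) hmax
            ((hwin' x hxb).mono fun y hy => hy ▸ le_max_right _ _) hwx
        have h2 := infLaplacian_le_of_isLocalMax_sub (h1.2.2.1.add contDiffAt_const) hφ' hloc
        rw [infLaplacian_add_const] at h2
        have h3 : dist (w x) (u x₀) < τ := by
          have h4 := h1.2.2.2.2
          rw [Real.dist_eq, abs_lt] at h4 ⊢
          constructor <;> linarith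
        have h5 := hτ' (x, w x) (by simp [Prod.dist_eq, h1.2.1, h3])
        simp only at h5
        linarith
    · have hxb : x ∉ ball x₀ ρ := fun h =>
        (hΩ.frontier_eq ▸ hx : x ∈ closure Ω \ Ω).2 (hρ' (ball_subset_closedBall h)).1
      rw [(hwout' x hxb).eq_of_nhds]
      exact huadm.2.2 x hx
  have h1 := hu.le hwadm (subset_closure hx₀)
  rw [hwin x₀ (mem_ball_self hρ), hψ0] at h1
  have h2 := le_max_right (u x₀) (u x₀ + ε)
  linarith

/-- Solvability of the Dirichlet problem for bounded right-hand sides. -/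
theorem exists_isDirichletSolution_of_bounded (hΩ : IsOpen Ω) (hbdd : Bornology.IsBounded Ω)
    (hne : (frontier Ω).Nonempty)
    (hf : ContinuousOn (fun p : EuclideanSpace ℝ (Fin N) × ℝ => f p.1 p.2) (Ω ×ˢ Set.univ))
    (hb : ContinuousOn b (frontier Ω)) {M : ℝ} (hM : ∀ x ∈ Ω, ∀ t, |f x t| ≤ M) :
    ∃ u, IsDirichletSolution Ω f b u := by
  obtain ⟨u, hu⟩ := exists_isPerron hΩ hbdd hne hb hM
  have huc : ∀ x ∈ Ω, ContinuousAt u x := fun x hx => hu.continuousAt hΩ hbdd hne hb hM hx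
  have hfr : ∀ x ∈ frontier Ω, u x = b x := fun x hx => hu.eq_on_frontier hΩ hbdd hb hM hx
  have hcl : ContinuousOn u (closure Ω) := fun x hx => by
    by_cases hxΩ : x ∈ Ω
    · exact (huc x hxΩ).continuousWithinAt
    · exact hu.continuousWithinAt_frontier hΩ hbdd hb hM (hΩ.frontier_eq ▸ ⟨hx, hxΩ⟩)
  have hsub := hu.isSubsolution hΩ hf huc
  exact ⟨u, hcl, hsub, hu.isSupersolution hΩ hf ⟨hcl, hsub, fun x hx => (hfr x hx).le⟩, hfr⟩

end Perron

/-! ### A priori bounds and the main theorem -/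

section APriori

variable {N : ℕ} {Ω : Set (EuclideanSpace ℝ (Fin N))}
  {f : EuclideanSpace ℝ (Fin N) → ℝ → ℝ} {b u v : EuclideanSpace ℝ (Fin N) → ℝ}

theorem sigma_pos : 0 < sigma := by unfold sigma; positivity

/-- This is the normalisation `(64/81) σ³ = 1`, the coefficient in `infLaplacian_radialPower` at `p
= 2/3`. -/
theorem sigma_cube : sigma ^ 3 = 81 / 64 := by
  unfold sigma
  rw [div_pow, ← Real.rpow_mul_natCast (by norm_num)]
  norm_num

/-- The sharp radial bound for subsolutions whose right-hand side is at least `-C³` above the level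
`m`, where `m` bounds the boundary values. -/
theorem IsSubsolution.le_add_of_rhs_ge (hΩ : IsOpen Ω) (hbdd : Bornology.IsBounded Ω)
    (hv : IsSubsolution Ω f v) (hvc : ContinuousOn v (closure Ω)) {m C : ℝ} (hC : 0 ≤ C)
    (hf : ∀ x ∈ Ω, ∀ t, m < t → -C ^ 3 ≤ f x t) (hm : ∀ x ∈ frontier Ω, v x ≤ m)
    (hne : (frontier Ω).Nonempty) {x : EuclideanSpace ℝ (Fin N)} (hx : x ∈ closure Ω) :
    v x ≤ m + sigma * C * (diam Ω ^ 2) ^ (2 / 3 : ℝ) := by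
  obtain ⟨z, hz⟩ := hne
  have hσ := sigma_pos
  set κ : ℝ := (diam Ω ^ 2) ^ (2 / 3 : ℝ) with hκdef
  have hκ : 0 ≤ κ := by positivity
  have hzΩ : ∀ y ∈ Ω, y ≠ z := fun y hy h => by
    subst h
    exact (hΩ.frontier_eq ▸ hz : y ∈ closure Ω \ Ω).2 hy
  have hdist : ∀ y ∈ closure Ω, (‖y - z‖ ^ 2) ^ (2 / 3 : ℝ) ≤ κ := fun y hy => by
    have h : ‖y - z‖ ≤ diam Ω := by
      rw [← dist_eq_norm, ← diam_closure]
      exact dist_le_diam_of_mem hbdd.closure hy (frontier_subset_closure hz)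
    simp only [hκdef]
    gcongr
  -- Enlarging `C` makes the comparison strict; `C'` is then sent back to `C`.
  have key : ∀ C', C < C' → v x ≤ m + sigma * C' * κ := by
    intro C' hC'
    have hC'0 : 0 < C' := hC.trans_lt hC'
    -- The comparison function stays above `m`, so `v` exceeds it only where `v > m`, which is where
    -- the bound on `f` is assumed.
    have hge : ∀ y ∈ closure Ω,
        m ≤ radialPower z (2 / 3) (-(sigma * C')) (m + sigma * C' * κ) y := fun y hy => by
      have h : sigma * C' * (‖y - z‖ ^ 2) ^ (2 / 3 : ℝ) ≤ sigma * C' * κ := by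
        have := hdist y hy
        gcongr
      unfold radialPower
      linarith
    have h := hv.le_of_strict (φ := radialPower z (2 / 3) (-(sigma * C')) (m + sigma * C' * κ))
      hΩ hbdd.isCompact_closure hΩ subset_closure subset_rfl hvc
      (continuous_radialPower z (by norm_num) _ _).continuousOn
      (fun y hy => contDiffAt_radialPower (hzΩ y hy) _ _ _) (fun y hy hlt => ?_)
      (fun y hy hyΩ => (hm y (hΩ.frontier_eq ▸ ⟨hy, hyΩ⟩)).trans (hge y hy)) x hx
    · refine h.trans ?_
      have : 0 ≤ sigma * C' * (‖x - z‖ ^ 2) ^ (2 / 3 : ℝ) := by positivity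
      unfold radialPower
      linarith
    · have h1 := hf y hy (v y) ((hge y (subset_closure hy)).trans_lt hlt)
      have h2 : C ^ 3 < C' ^ 3 := by gcongr
      have h3 : infLaplacian (radialPower z (2 / 3) (-(sigma * C')) (m + sigma * C' * κ)) y
          = -C' ^ 3 := by
        rw [infLaplacian_radialPower (hzΩ y hy)]
        norm_num
        linear_combination (-(64 / 81) * C' ^ 3) * sigma_cube
      rw [h3]
      linarith
  refine le_of_forall_pos_le_add fun ε hε => ?_
  have h := key (C + ε / (sigma * κ + 1)) (by linarith [show 0 < ε / (sigma * κ + 1) by positivity])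
  have h1 : ε / (sigma * κ + 1) * (sigma * κ) ≤ ε := by
    rw [div_mul_eq_mul_div, div_le_iff₀ (by positivity)]
    nlinarith
  linarith

theorem sizeConst_nonneg (η : ℝ) : 0 ≤ sizeConst Ω f b η := by
  refine le_max_of_le_left (Real.rpow_nonneg (Real.sSup_nonneg ?_) _)
  rintro _ ⟨p, -, rfl⟩
  exact le_max_right _ _

theorem exists_level_of_diam_lt (h : ENNReal.ofReal (diam Ω) < diamBound Ω f b) :
    ∃ η : ℝ, 0 ≤ η ∧ sigma * sizeConst Ω f b η * (diam Ω ^ 2) ^ (2 / 3 : ℝ) ≤ η := by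
  unfold diamBound at h
  split_ifs at h with h0
  · obtain ⟨η, hη, hC⟩ := h0
    exact ⟨η, hη, by simpa [hC] using hη⟩
  · push Not at h0
    simp only [lt_iSup_iff] at h
    obtain ⟨η, hη, h⟩ := h
    have hC : 0 < sizeConst Ω f b η := lt_of_le_of_ne (sizeConst_nonneg η) (h0 η hη.le).symm
    have hσ := sigma_pos
    refine ⟨η, hη.le, ?_⟩
    have hlt := (ENNReal.ofReal_lt_ofReal_iff_of_nonneg diam_nonneg).1 h
    have hq : 0 < η / (sigma * sizeConst Ω f b η) := by positivity
    have hκ : (diam Ω ^ 2) ^ (2 / 3 : ℝ) ≤ η / (sigma * sizeConst Ω f b η) := by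
      calc (diam Ω ^ 2) ^ (2 / 3 : ℝ)
          ≤ (((η / (sigma * sizeConst Ω f b η)) ^ (3 / 4 : ℝ)) ^ 2) ^ (2 / 3 : ℝ) := by
            have := diam_nonneg (s := Ω)
            gcongr
        _ = η / (sigma * sizeConst Ω f b η) := by
            rw [← Real.rpow_mul_natCast hq.le, ← Real.rpow_mul hq.le]
            norm_num
    rw [le_div_iff₀ (by positivity)] at hκ
    linarith

theorem le_sizeConst_cube {η M : ℝ}
    (hM : ∀ x ∈ Ω, ∀ t ∈ Icc (bdryInf Ω b - η) (bdryInf Ω b), |f x t| ≤ M)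
    {x : EuclideanSpace ℝ (Fin N)} (hx : x ∈ Ω) {t : ℝ}
    (ht : t ∈ Icc (bdryInf Ω b - η) (bdryInf Ω b)) : f x t ≤ sizeConst Ω f b η ^ 3 := by
  set S := sSup ((fun p : EuclideanSpace ℝ (Fin N) × ℝ => max (f p.1 p.2) 0) ''
      (Ω ×ˢ Set.Icc (bdryInf Ω b - η) (bdryInf Ω b)))
  have hle : max (f x t) 0 ≤ S := by
    refine le_csSup ⟨max M 0, ?_⟩ ⟨(x, t), ⟨hx, ht⟩, rfl⟩
    rintro _ ⟨p, hp, rfl⟩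
    exact max_le_max_right 0 (le_of_abs_le (hM p.1 hp.1 p.2 hp.2))
  have hS0 : 0 ≤ S := (le_max_right _ _).trans hle
  have h1 : S ^ (1 / 3 : ℝ) ≤ sizeConst Ω f b η := le_max_left _ _
  calc f x t ≤ S := (le_max_left _ _).trans hle
    _ = (S ^ (1 / 3 : ℝ)) ^ 3 := by rw [← Real.rpow_mul_natCast hS0]; norm_num
    _ ≤ sizeConst Ω f b η ^ 3 := by gcongr

theorem neg_sizeConst_cube_le {η M : ℝ}
    (hM : ∀ x ∈ Ω, ∀ t ∈ Icc (bdrySup Ω b) (bdrySup Ω b + η), |f x t| ≤ M)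
    {x : EuclideanSpace ℝ (Fin N)} (hx : x ∈ Ω) {t : ℝ}
    (ht : t ∈ Icc (bdrySup Ω b) (bdrySup Ω b + η)) : -sizeConst Ω f b η ^ 3 ≤ f x t := by
  set S := sInf ((fun p : EuclideanSpace ℝ (Fin N) × ℝ => min (f p.1 p.2) 0) ''
      (Ω ×ˢ Set.Icc (bdrySup Ω b) (bdrySup Ω b + η)))
  have hle : S ≤ min (f x t) 0 := by
    refine csInf_le ⟨min (-M) 0, ?_⟩ ⟨(x, t), ⟨hx, ht⟩, rfl⟩
    rintro _ ⟨p, hp, rfl⟩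
    exact min_le_min_right 0 (neg_le_of_abs_le (hM p.1 hp.1 p.2 hp.2))
  have hS0 : 0 ≤ -S := by linarith [min_le_right (f x t) 0]
  have h1 : (-S) ^ (1 / 3 : ℝ) ≤ sizeConst Ω f b η := le_max_right _ _
  have h2 : -S ≤ sizeConst Ω f b η ^ 3 := by
    calc -S = ((-S) ^ (1 / 3 : ℝ)) ^ 3 := by rw [← Real.rpow_mul_natCast hS0]; norm_num
      _ ≤ sizeConst Ω f b η ^ 3 := by gcongr
  linarith [min_le_left (f x t) 0]

theorem frontier_nonempty_of_isBounded (hN : 2 ≤ N) (hΩ : Ω.Nonempty)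
    (hbdd : Bornology.IsBounded Ω) : (frontier Ω).Nonempty := by
  have : Nonempty (Fin N) := ⟨⟨0, by omega⟩⟩
  refine nonempty_frontier_iff.2 ⟨hΩ, fun h => ?_⟩
  exact NormedSpace.unbounded_univ ℝ (EuclideanSpace ℝ (Fin N)) (h ▸ hbdd)

end APriori

end InfDirichlet

open InfDirichlet in
theorem theorem3p4 {N : ℕ} (hN : 2 ≤ N) (Ω : Set (EuclideanSpace ℝ (Fin N)))
    (hΩ_open : IsOpen Ω) (hΩ_conn : IsConnected Ω) (hΩ_bdd : Bornology.IsBounded Ω)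
    (f : EuclideanSpace ℝ (Fin N) → ℝ → ℝ)
    (hf : ContinuousOn (fun p : EuclideanSpace ℝ (Fin N) × ℝ => f p.1 p.2) (Ω ×ˢ Set.univ))
    (hf_bdd : ∀ s t : ℝ, ∃ M : ℝ, ∀ x ∈ Ω, ∀ r ∈ Set.Icc s t, |f x r| ≤ M)
    (b : EuclideanSpace ℝ (Fin N) → ℝ) (hb : ContinuousOn b (frontier Ω))
    (hdiam : ENNReal.ofReal (Metric.diam Ω) < InfDirichlet.diamBound Ω f b) :
    ∃ u : EuclideanSpace ℝ (Fin N) → ℝ, InfDirichlet.IsDirichletSolution Ω f b u := by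
  have hne := frontier_nonempty_of_isBounded hN hΩ_conn.nonempty hΩ_bdd
  have hFc : IsCompact (frontier Ω) :=
    hΩ_bdd.isCompact_closure.of_isClosed_subset isClosed_frontier frontier_subset_closure
  have hlow : ∀ x ∈ frontier Ω, bdryInf Ω b ≤ b x := fun x hx =>
    csInf_le (hFc.image_of_continuousOn hb).bddBelow ⟨x, hx, rfl⟩
  have hup : ∀ x ∈ frontier Ω, b x ≤ bdrySup Ω b := fun x hx =>
    le_csSup (hFc.image_of_continuousOn hb).bddAbove ⟨x, hx, rfl⟩
  have hlL : bdryInf Ω b ≤ bdrySup Ω b := by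
    obtain ⟨z, hz⟩ := hne
    exact (hlow z hz).trans (hup z hz)
  obtain ⟨η, hη, hsmall⟩ := exists_level_of_diam_lt hdiam
  obtain ⟨M, hM⟩ := hf_bdd (bdryInf Ω b - η) (bdrySup Ω b + η)
  have hlL' : bdryInf Ω b - η ≤ bdrySup Ω b + η := by linarith
  -- Projection onto `[ℓ - η, L + η]`.
  set cl : ℝ → ℝ := fun t => max (bdryInf Ω b - η) (min (bdrySup Ω b + η) t) with hcl
  have hclc : Continuous cl := continuous_const.max (continuous_const.min continuous_id)
  obtain ⟨u, huc, hsub, hsuper, hub⟩ := exists_isDirichletSolution_of_bounded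
    (f := fun x t => f x (cl t)) (M := M) hΩ_open hΩ_bdd hne
    (hf.comp (g := fun p : EuclideanSpace ℝ (Fin N) × ℝ => f p.1 p.2)
      (f := fun p : EuclideanSpace ℝ (Fin N) × ℝ => (p.1, cl p.2))
      (continuous_fst.prodMk (hclc.comp continuous_snd)).continuousOn
      fun p hp => ⟨hp.1, trivial⟩) hb
    (fun x hx t => hM x hx _ ⟨le_max_left _ _, max_le hlL' (min_le_left _ _)⟩)
  have hupper : ∀ x ∈ closure Ω, u x ≤ bdrySup Ω b + η := fun x hx => by
    refine (hsub.le_add_of_rhs_ge hΩ_open hΩ_bdd huc (sizeConst_nonneg (Ω := Ω) (f := f) (b := b) η)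
      (fun y hy t ht => ?_) (fun y hy => (hub y hy).trans_le (hup y hy)) hne hx).trans
      (by linarith)
    -- For `t > L` the truncated value lies in `[L, L + η]`, the interval that enters `C(η)`.
    refine neg_sizeConst_cube_le (M := M)
      (fun p hp s hs => hM p hp s ⟨by linarith [hs.1], hs.2⟩) hy ⟨?_, ?_⟩
    · exact le_max_of_le_right (le_min (by linarith) ht.le)
    · exact max_le hlL' (min_le_left _ _)
  have hlower : ∀ x ∈ closure Ω, bdryInf Ω b - η ≤ u x := fun x hx => by
    have h := (hsuper.neg hΩ_open).le_add_of_rhs_ge hΩ_open hΩ_bdd huc.neg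
      (m := -bdryInf Ω b) (sizeConst_nonneg (Ω := Ω) (f := f) (b := b) η)
      (fun y hy t ht => ?_) (fun y hy => ?_) hne hx
    · linarith
    · refine neg_le_neg (le_sizeConst_cube (M := M)
        (fun p hp s hs => hM p hp s ⟨hs.1, by linarith [hs.2]⟩) hy ⟨le_max_left _ _, ?_⟩)
      exact max_le (by linarith) ((min_le_right _ _).trans (by linarith))
    · rw [hub y hy]
      exact neg_le_neg (hlow y hy)
  have hcl_u : ∀ x ∈ Ω, cl (u x) = u x := fun x hx => by
    have hx' := subset_closure hx
    simp only [hcl]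
    rw [min_eq_right (hupper x hx'), max_eq_right (hlower x hx')]
  refine ⟨u, huc, ⟨hsub.1, fun ψ hψ x hx h => ?_⟩, ⟨hsuper.1, fun ψ hψ x hx h => ?_⟩, hub⟩
  · simpa only [hcl_u x hx] using hsub.2 ψ hψ x hx h
  · simpa only [hcl_u x hx] using hsuper.2 ψ hψ x hx h
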